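/- Let $\mathcal H_0,\mathcal H_1,\tilde{\mathcal H}_0,\tilde{\mathcal H}_1$ be complex Hilbert spaces, let $T_i\in\mathcal L(\mathcal H_i)$ and $\tilde T_i\in\mathcal L(\tilde{\mathcal H}_i)$ $(i=0,1)$, $X\in\mathcal L(\mathcal H_1,\mathcal H_0)$ and $Y\in\mathcal L(\tilde{\mathcal H}_1,\tilde{\mathcal H}_0)$ be bounded linear operators, and put $$T=\begin{pmatrix}T_0&XT_1-T_0X\\0&T_1\end{pmatrix}\ \text{on}\ \mathcal H_0\oplus\mathcal H_1,\qquad \tilde T=\begin{pmatrix}\tilde T_0&Y\tilde T_1-\tilde T_0Y\\0&\tilde T_1\end{pmatrix}\ \text{on}\ \tilde{\mathcal H}_0\oplus\tilde{\mathcal H}_1 .$$ For bounded operators $A$ on a Hilbert space $\mathcal K_1$ and $B$ on a Hilbert space $\mathcal K_2$, write $\sigma_{A,B}(Z)=AZ-ZB$ for $Z\in\mathcal L(\mathcal K_2,\mathcal K_1)$. Assume that $\operatorname{Ker}\sigma_{T_0,\tilde T_0}=\operatorname{Ker}\sigma_{\tilde T_1,T_1}=\{0\}$. For $U_{01}\in\mathcal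 L(\mathcal H_1,\tilde{\mathcal H}_0)$ and $U_{10}\in\mathcal L(\mathcal H_0,\tilde{\mathcal H}_1)$ consider the following conditions: 0. $U_{01}$ and $U_{10}$ are invertible (with bounded inverse); 1. $U_{10}T_0U_{10}^{-1}=\tilde T_1$ and $(U_{01}^{*})^{-1}T_1U_{01}^*=\tilde T_0$; 2. $(1+XX^*)^{-1}=U_{10}^*U_{10}$ and $(1+X^*X)^{-1}=U_{01}^*U_{01}$; 3. $Y-U_{01}X^*U_{10}^{-1}\in\operatorname{Ker}\sigma_{\tilde T_0,\tilde T_1}$. Then there exists a unitary operator $U:\mathcal H_0\oplus\mathcal H_1\to\tilde{\mathcal H}_0\oplus\tilde{\mathcal H}_1$ with $UT=\tilde TU$ if and only if there exist $U_{01}$ and $U_{10}$ satisfying 0–3. More precisely, a bounded operator $U=\begin{pmatrix}U_{00}&U_{01}\\U_{10}&U_{11}\end{pmatrix}:\mathcal H_0\oplus\mathcal H_1\to\tilde{\mathcal H}_0\oplus\tilde{\mathcal H}_1$ is unitary with $UT=\tilde TU$ if and only if its entries $U_{01},U_{10}$ satisfy 0–3 and $$U=\begin{pmatrix}U_{01}X^*&U_{01}\\U_{10}&-U_{10}X\end{pmatrix}.$$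 -/

import Mathlib

open scoped InnerProduct

/-- The Hilbert space direct sum `H₀ ⊕ H₁` (the product with the `ℓ²` norm). -/
abbrev HilbertSum (H₀ H₁ : Type*) : Type _ := WithLp 2 (H₀ × H₁)

/-- The bounded operator `H₀ ⊕ H₁ → K₀ ⊕ K₁` with operator matrix `[[A, B], [C, D]]`, that is,
`(x, y) ↦ (A x + B y, C x + D y)`. -/
noncomputable def blockOp {H₀ H₁ K₀ K₁ : Type*}
    [NormedAddCommGroup H₀] [InnerProductSpace ℂ H₀]
    [NormedAddCommGroup H₁] [InnerProductSpace ℂ H₁]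
    [NormedAddCommGroup K₀] [InnerProductSpace ℂ K₀]
    [NormedAddCommGroup K₁] [InnerProductSpace ℂ K₁]
    (A : H₀ →L[ℂ] K₀) (B : H₁ →L[ℂ] K₀) (C : H₀ →L[ℂ] K₁) (D : H₁ →L[ℂ] K₁) :
    HilbertSum H₀ H₁ →L[ℂ] HilbertSum K₀ K₁ :=
  ((WithLp.prodContinuousLinearEquiv 2 ℂ K₀ K₁).symm :
      K₀ × K₁ →L[ℂ] HilbertSum K₀ K₁) ∘L
    ((A ∘L WithLp.fstL 2 ℂ H₀ H₁ + B ∘L WithLp.sndL 2 ℂ H₀ H₁).prod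
      (C ∘L WithLp.fstL 2 ℂ H₀ H₁ + D ∘L WithLp.sndL 2 ℂ H₀ H₁))

/-- The linear operator `σ_{A,B} : L(H₂, H₁) → L(H₂, H₁)`, `σ_{A,B}(Z) = A Z - Z B`,
for `A ∈ L(H₁)` and `B ∈ L(H₂)`. -/
noncomputable def sigmaOp {H₁ H₂ : Type*}
    [NormedAddCommGroup H₁] [InnerProductSpace ℂ H₁]
    [NormedAddCommGroup H₂] [InnerProductSpace ℂ H₂]
    (A : H₁ →L[ℂ] H₁) (B : H₂ →L[ℂ] H₂) : (H₂ →L[ℂ] H₁) →ₗ[ℂ] (H₂ →L[ℂ] H₁) where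
  toFun Z := A ∘L Z - Z ∘L B
  map_add' Z W := by
    ext v
    simp only [sub_apply, ContinuousLinearMap.comp_apply,
      add_apply, map_add]
    abel
  map_smul' c Z := by
    ext v
    simp [smul_sub]

/-- The operator `[[T₀, X T₁ - T₀ X], [0, T₁]]` on `H₀ ⊕ H₁`. -/
noncomputable def upperOp {H₀ H₁ : Type*}
    [NormedAddCommGroup H₀] [InnerProductSpace ℂ H₀]
    [NormedAddCommGroup H₁] [InnerProductSpace ℂ H₁]
    (T₀ : H₀ →L[ℂ] H₀) (T₁ : H₁ →L[ℂ] H₁) (X : H₁ →L[ℂ] H₀) :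
    HilbertSum H₀ H₁ →L[ℂ] HilbertSum H₀ H₁ :=
  blockOp T₀ (X ∘L T₁ - T₀ ∘L X) 0 T₁

/-- A bounded operator between Hilbert spaces is unitary if `U* U = 1` and `U U* = 1`. -/
def IsUnitaryOp {H K : Type*}
    [NormedAddCommGroup H] [InnerProductSpace ℂ H] [CompleteSpace H]
    [NormedAddCommGroup K] [InnerProductSpace ℂ K] [CompleteSpace K]
    (U : H →L[ℂ] K) : Prop :=
  U† ∘L U = ContinuousLinearMap.id ℂ H ∧ U ∘L U† = ContinuousLinearMap.id ℂ K

/-- The three conditions on the off-diagonal entries `U₀₁`, `U₁₀`. Both entries are required to be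
boundedly invertible, so that `inverse` is the genuine inverse; the operators `1 + X X*` and
`1 + X* X` are always invertible. -/
structure IntertwiningConditions {H₀ H₁ K₀ K₁ : Type*}
    [NormedAddCommGroup H₀] [InnerProductSpace ℂ H₀] [CompleteSpace H₀]
    [NormedAddCommGroup H₁] [InnerProductSpace ℂ H₁] [CompleteSpace H₁]
    [NormedAddCommGroup K₀] [InnerProductSpace ℂ K₀] [CompleteSpace K₀]
    [NormedAddCommGroup K₁] [InnerProductSpace ℂ K₁] [CompleteSpace K₁]
    (T₀ : H₀ →L[ℂ] H₀) (T₁ : H₁ →L[ℂ] H₁) (X : H₁ →L[ℂ] H₀)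
    (S₀ : K₀ →L[ℂ] K₀) (S₁ : K₁ →L[ℂ] K₁) (Y : K₁ →L[ℂ] K₀)
    (U₀₁ : H₁ →L[ℂ] K₀) (U₁₀ : H₀ →L[ℂ] K₁) : Prop where
  invertible₀₁ : U₀₁.IsInvertible
  invertible₁₀ : U₁₀.IsInvertible
  similar₁₀ : U₁₀ ∘L T₀ ∘L U₁₀.inverse = S₁
  similar₀₁ : (U₀₁†).inverse ∘L T₁ ∘L U₀₁† = S₀
  gram₁₀ : (ContinuousLinearMap.id ℂ H₀ + X ∘L X†).inverse = U₁₀† ∘L U₁₀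
  gram₀₁ : (ContinuousLinearMap.id ℂ H₁ + X† ∘L X).inverse = U₀₁† ∘L U₀₁
  mem_ker : Y - U₀₁ ∘L X† ∘L U₁₀.inverse ∈ LinearMap.ker (sigmaOp S₀ S₁)

/-! ### Operator matrices on Hilbert sums. -/

section Block

/-! With `W_X = [[1, X], [0, 1]]` one has `T = W_X (T₀ ⊕ T₁) W_X⁻¹`, so `U` intertwines iff `W_Y⁻¹ U
W_X` intertwines the diagonal operators `T₀ ⊕ T₁` and `S₀ ⊕ S₁`. Its lower right entry `U₁₀ X + U₁₁`
lies in `Ker σ_{S₁,T₁}`, hence vanishes. For unitary `U` the adjoint intertwines the other way, and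
the upper left entry `U₀₀* - X U₀₁*` of `W_X⁻¹ U* W_Y` lies in `Ker σ_{T₀,S₀}`, hence vanishes too.
This fixes the shape of `U`. The remaining diagonal-block relations are conditions 1 and 3, and
unitarity becomes the Gram conditions 2.

Conversely, the Gram conditions and `X (1 + X* X)⁻¹ = (1 + X X*)⁻¹ X` make the prescribed matrix
unitary, and conditions 1–3 together give the four entries of the intertwining relation. -/

theorem HilbertSum.ext {E F : Type*} {v w : HilbertSum E F} (h₀ : v.fst = w.fst)
    (h₁ : v.snd = w.snd) : v = w :=
  WithLp.ofLp_injective 2 (Prod.ext h₀ h₁)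

variable {H₀ H₁ K₀ K₁ L₀ L₁ : Type*}
  [NormedAddCommGroup H₀] [InnerProductSpace ℂ H₀]
  [NormedAddCommGroup H₁] [InnerProductSpace ℂ H₁]
  [NormedAddCommGroup K₀] [InnerProductSpace ℂ K₀]
  [NormedAddCommGroup K₁] [InnerProductSpace ℂ K₁]
  [NormedAddCommGroup L₀] [InnerProductSpace ℂ L₀]
  [NormedAddCommGroup L₁] [InnerProductSpace ℂ L₁]

@[simp]
theorem blockOp_apply_fst (A : H₀ →L[ℂ] K₀) (B : H₁ →L[ℂ] K₀) (C : H₀ →L[ℂ] K₁)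
    (D : H₁ →L[ℂ] K₁) (v : HilbertSum H₀ H₁) :
    (blockOp A B C D v).fst = A v.fst + B v.snd := rfl

@[simp]
theorem blockOp_apply_snd (A : H₀ →L[ℂ] K₀) (B : H₁ →L[ℂ] K₀) (C : H₀ →L[ℂ] K₁)
    (D : H₁ →L[ℂ] K₁) (v : HilbertSum H₀ H₁) :
    (blockOp A B C D v).snd = C v.fst + D v.snd := rfl

theorem exists_eq_blockOp (U : HilbertSum H₀ H₁ →L[ℂ] HilbertSum K₀ K₁) :
    ∃ A B C D, U = blockOp A B C D := by
  let i₀ : H₀ →L[ℂ] HilbertSum H₀ H₁ :=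
    ((WithLp.prodContinuousLinearEquiv 2 ℂ H₀ H₁).symm : H₀ × H₁ →L[ℂ] HilbertSum H₀ H₁) ∘L
      ContinuousLinearMap.inl ℂ H₀ H₁
  let i₁ : H₁ →L[ℂ] HilbertSum H₀ H₁ :=
    ((WithLp.prodContinuousLinearEquiv 2 ℂ H₀ H₁).symm : H₀ × H₁ →L[ℂ] HilbertSum H₀ H₁) ∘L
      ContinuousLinearMap.inr ℂ H₀ H₁
  refine ⟨WithLp.fstL 2 ℂ K₀ K₁ ∘L U ∘L i₀, WithLp.fstL 2 ℂ K₀ K₁ ∘L U ∘L i₁,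
    WithLp.sndL 2 ℂ K₀ K₁ ∘L U ∘L i₀, WithLp.sndL 2 ℂ K₀ K₁ ∘L U ∘L i₁, ?_⟩
  ext1 v
  have hv : v = i₀ v.fst + i₁ v.snd := HilbertSum.ext (by simp [i₀, i₁]) (by simp [i₀, i₁])
  have hU : U v = U (i₀ v.fst) + U (i₁ v.snd) := by
    rw [← map_add, ← hv]
  refine HilbertSum.ext ?_ ?_ <;> simp [hU]

theorem blockOp_inj {A A' : H₀ →L[ℂ] K₀} {B B' : H₁ →L[ℂ] K₀} {C C' : H₀ →L[ℂ] K₁}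
    {D D' : H₁ →L[ℂ] K₁} :
    blockOp A B C D = blockOp A' B' C' D' ↔ A = A' ∧ B = B' ∧ C = C' ∧ D = D' := by
  refine ⟨fun h => ?_, by rintro ⟨rfl, rfl, rfl, rfl⟩; rfl⟩
  have h₀ (v : H₀) := congrArg (· (WithLp.toLp 2 (v, (0 : H₁)))) h
  have h₁ (v : H₁) := congrArg (· (WithLp.toLp 2 ((0 : H₀), v))) h
  refine ⟨?_, ?_, ?_, ?_⟩ <;> ext v
  · simpa using congrArg WithLp.fst (h₀ v)
  · simpa using congrArg WithLp.fst (h₁ v)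
  · simpa using congrArg WithLp.snd (h₀ v)
  · simpa using congrArg WithLp.snd (h₁ v)

theorem blockOp_comp (A : K₀ →L[ℂ] L₀) (B : K₁ →L[ℂ] L₀) (C : K₀ →L[ℂ] L₁) (D : K₁ →L[ℂ] L₁)
    (A' : H₀ →L[ℂ] K₀) (B' : H₁ →L[ℂ] K₀) (C' : H₀ →L[ℂ] K₁) (D' : H₁ →L[ℂ] K₁) :
    blockOp A B C D ∘L blockOp A' B' C' D' =
      blockOp (A ∘L A' + B ∘L C') (A ∘L B' + B ∘L D') (C ∘L A' + D ∘L C')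
        (C ∘L B' + D ∘L D') := by
  ext1 v
  refine HilbertSum.ext ?_ ?_ <;> simp <;> abel

theorem id_eq_blockOp :
    ContinuousLinearMap.id ℂ (HilbertSum H₀ H₁) =
      blockOp (ContinuousLinearMap.id ℂ H₀) 0 0 (ContinuousLinearMap.id ℂ H₁) := by
  ext1 v
  refine HilbertSum.ext ?_ ?_ <;> simp

theorem blockOp_adjoint [CompleteSpace H₀] [CompleteSpace H₁] [CompleteSpace K₀]
    [CompleteSpace K₁] (A : H₀ →L[ℂ] K₀) (B : H₁ →L[ℂ] K₀) (C : H₀ →L[ℂ] K₁)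
    (D : H₁ →L[ℂ] K₁) : (blockOp A B C D)† = blockOp (A†) (C†) (B†) (D†) := by
  symm
  rw [ContinuousLinearMap.eq_adjoint_iff]
  intro v w
  simp [WithLp.prod_inner_apply, inner_add_left, inner_add_right,
    ContinuousLinearMap.adjoint_inner_left]
  abel

theorem blockOp_comp_upperOp_eq_iff {A : H₀ →L[ℂ] K₀} {B : H₁ →L[ℂ] K₀} {C : H₀ →L[ℂ] K₁}
    {D : H₁ →L[ℂ] K₁} {T₀ : H₀ →L[ℂ] H₀} {T₁ : H₁ →L[ℂ] H₁} {X : H₁ →L[ℂ] H₀}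
    {S₀ : K₀ →L[ℂ] K₀} {S₁ : K₁ →L[ℂ] K₁} {Y : K₁ →L[ℂ] K₀} :
    blockOp A B C D ∘L upperOp T₀ T₁ X = upperOp S₀ S₁ Y ∘L blockOp A B C D ↔
      (∀ v, A (T₀ v) = S₀ (A v) + (Y (S₁ (C v)) - S₀ (Y (C v)))) ∧
      (∀ v, A (X (T₁ v)) - A (T₀ (X v)) + B (T₁ v) =
        S₀ (B v) + (Y (S₁ (D v)) - S₀ (Y (D v)))) ∧
      (∀ v, C (T₀ v) = S₁ (C v)) ∧
      (∀ v, C (X (T₁ v)) - C (T₀ (X v)) + D (T₁ v) = S₁ (D v)) := by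
  simp only [upperOp, blockOp_comp, blockOp_inj]
  simp [ContinuousLinearMap.ext_iff]

end Block

/-! ### Unitary intertwiners and the conditions on their off-diagonal entries. -/

section Intertwining

theorem mem_ker_sigmaOp {E F : Type*}
    [NormedAddCommGroup E] [InnerProductSpace ℂ E] [NormedAddCommGroup F] [InnerProductSpace ℂ F]
    {A : E →L[ℂ] E} {B : F →L[ℂ] F} {Z : F →L[ℂ] E} :
    Z ∈ LinearMap.ker (sigmaOp A B) ↔ ∀ v, A (Z v) = Z (B v) := by
  simp [sigmaOp, sub_eq_zero, ContinuousLinearMap.ext_iff]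

variable {H₀ H₁ K₀ K₁ : Type*}
  [NormedAddCommGroup H₀] [InnerProductSpace ℂ H₀] [CompleteSpace H₀]
  [NormedAddCommGroup H₁] [InnerProductSpace ℂ H₁] [CompleteSpace H₁]
  [NormedAddCommGroup K₀] [InnerProductSpace ℂ K₀] [CompleteSpace K₀]
  [NormedAddCommGroup K₁] [InnerProductSpace ℂ K₁] [CompleteSpace K₁]

theorem isUnitaryOp_blockOp_iff {A : H₀ →L[ℂ] K₀} {B : H₁ →L[ℂ] K₀} {C : H₀ →L[ℂ] K₁}
    {D : H₁ →L[ℂ] K₁} :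
    IsUnitaryOp (blockOp A B C D) ↔
      ((∀ v, (A†) (A v) + (C†) (C v) = v) ∧ (∀ v, (A†) (B v) + (C†) (D v) = 0) ∧
        (∀ v, (B†) (A v) + (D†) (C v) = 0) ∧ (∀ v, (B†) (B v) + (D†) (D v) = v)) ∧
      ((∀ v, A ((A†) v) + B ((B†) v) = v) ∧ (∀ v, A ((C†) v) + B ((D†) v) = 0) ∧
        (∀ v, C ((A†) v) + D ((B†) v) = 0) ∧ (∀ v, C ((C†) v) + D ((D†) v) = v)) := by
  simp only [IsUnitaryOp, blockOp_adjoint, blockOp_comp, id_eq_blockOp, blockOp_inj]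
  simp [ContinuousLinearMap.ext_iff]

/-- Needed because `σ_{T₀,S₀}` acts on operators `K₀ → H₀`: the hypothesis on its kernel applies to
entries of `U†`, not of `U`. -/
theorem IsUnitaryOp.adjoint_comp_eq {H K : Type*}
    [NormedAddCommGroup H] [InnerProductSpace ℂ H] [CompleteSpace H]
    [NormedAddCommGroup K] [InnerProductSpace ℂ K] [CompleteSpace K]
    {U : H →L[ℂ] K} (hU : IsUnitaryOp U) {T : H →L[ℂ] H} {S : K →L[ℂ] K}
    (h : U ∘L T = S ∘L U) : U† ∘L S = T ∘L U† := by
  calc U† ∘L S = U† ∘L S ∘L (U ∘L U†) := by rw [hU.2, ContinuousLinearMap.comp_id]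
    _ = U† ∘L (S ∘L U) ∘L U† := by simp only [ContinuousLinearMap.comp_assoc]
    _ = (U† ∘L U) ∘L T ∘L U† := by rw [← h]; simp only [ContinuousLinearMap.comp_assoc]
    _ = T ∘L U† := by rw [hU.1, ContinuousLinearMap.id_comp]

theorem isInvertible_adjoint {H K : Type*}
    [NormedAddCommGroup H] [InnerProductSpace ℂ H] [CompleteSpace H]
    [NormedAddCommGroup K] [InnerProductSpace ℂ K] [CompleteSpace K]
    {U : H →L[ℂ] K} (hU : U.IsInvertible) : (U†).IsInvertible := by
  refine .of_inverse (g := U.inverse†) ?_ ?_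
  · rw [← ContinuousLinearMap.adjoint_comp, hU.inverse_comp_self,
      ContinuousLinearMap.adjoint_id]
  · rw [← ContinuousLinearMap.adjoint_comp, hU.self_comp_inverse,
      ContinuousLinearMap.adjoint_id]

/-- A one-sided inverse of a self-adjoint operator by a self-adjoint operator is two-sided. -/
theorem inverse_eq_of_adjoint_eq_self {H : Type*}
    [NormedAddCommGroup H] [InnerProductSpace ℂ H] [CompleteSpace H]
    {P Q : H →L[ℂ] H} (hP : P† = P) (hQ : Q† = Q) (h : P ∘L Q = .id ℂ H) :
    P.inverse = Q := by
  refine ContinuousLinearMap.inverse_eq h ?_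
  have h' := congrArg ContinuousLinearMap.adjoint h
  rwa [ContinuousLinearMap.adjoint_comp, hP, hQ, ContinuousLinearMap.adjoint_id] at h'

theorem adjoint_id_add_adjoint_comp_self (X : H₁ →L[ℂ] H₀) :
    (.id ℂ H₁ + X† ∘L X : H₁ →L[ℂ] H₁)† = .id ℂ H₁ + X† ∘L X := by
  simp [ContinuousLinearMap.adjoint_comp, ContinuousLinearMap.adjoint_id]

theorem adjoint_adjoint_comp_self (X : H₁ →L[ℂ] H₀) : (X† ∘L X)† = X† ∘L X := by
  simp [ContinuousLinearMap.adjoint_comp]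

variable {T₀ : H₀ →L[ℂ] H₀} {T₁ : H₁ →L[ℂ] H₁} {X : H₁ →L[ℂ] H₀}
  {S₀ : K₀ →L[ℂ] K₀} {S₁ : K₁ →L[ℂ] K₁} {Y : K₁ →L[ℂ] K₀}

theorem intertwiningConditions_of_isUnitaryOp
    (h₀ : LinearMap.ker (sigmaOp T₀ S₀) = ⊥) (h₁ : LinearMap.ker (sigmaOp S₁ T₁) = ⊥)
    {U₀₀ : H₀ →L[ℂ] K₀} {U₀₁ : H₁ →L[ℂ] K₀} {U₁₀ : H₀ →L[ℂ] K₁} {U₁₁ : H₁ →L[ℂ] K₁}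
    (hU : IsUnitaryOp (blockOp U₀₀ U₀₁ U₁₀ U₁₁))
    (hT : blockOp U₀₀ U₀₁ U₁₀ U₁₁ ∘L upperOp T₀ T₁ X =
      upperOp S₀ S₁ Y ∘L blockOp U₀₀ U₀₁ U₁₀ U₁₁) :
    IntertwiningConditions T₀ T₁ X S₀ S₁ Y U₀₁ U₁₀ ∧
      U₀₀ = U₀₁ ∘L X† ∧ U₁₁ = -(U₁₀ ∘L X) := by
  have hS := hU.adjoint_comp_eq hT
  rw [blockOp_adjoint] at hS
  simp only [upperOp, blockOp_comp, blockOp_inj] at hS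
  simp only [ContinuousLinearMap.ext_iff] at hS
  obtain ⟨e₀₀, -, e₁₀, -⟩ := hS
  simp only [add_apply, sub_apply, ContinuousLinearMap.comp_apply, zero_apply, map_zero,
    add_zero, zero_add] at e₀₀ e₁₀
  obtain ⟨t₀₀, -, t₁₀, t₁₁⟩ := blockOp_comp_upperOp_eq_iff.1 hT
  -- the diagonal corners of the conjugated operator vanish by the kernel assumptions
  have hD : U₁₁ = -(U₁₀ ∘L X) := by
    have : U₁₀ ∘L X + U₁₁ ∈ LinearMap.ker (sigmaOp S₁ T₁) := by
      rw [mem_ker_sigmaOp]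
      intro v
      simp only [add_apply, ContinuousLinearMap.comp_apply, map_add, ← t₁₁, ← t₁₀]
      abel
    rw [h₁, Submodule.mem_bot] at this
    exact eq_neg_of_add_eq_zero_right this
  have hA' : U₀₀† = X ∘L U₀₁† := by
    have : U₀₀† - X ∘L U₀₁† ∈ LinearMap.ker (sigmaOp T₀ S₀) := by
      rw [mem_ker_sigmaOp]
      intro v
      simp only [sub_apply, ContinuousLinearMap.comp_apply, map_sub, e₀₀, e₁₀]
      abel
    rw [h₀, Submodule.mem_bot] at this
    exact sub_eq_zero.1 this
  have hA : U₀₀ = U₀₁ ∘L X† := by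
    have := congrArg ContinuousLinearMap.adjoint hA'
    rwa [ContinuousLinearMap.adjoint_adjoint, ContinuousLinearMap.adjoint_comp,
      ContinuousLinearMap.adjoint_adjoint] at this
  obtain ⟨⟨-, u₀₁, u₁₀, -⟩, -⟩ := isUnitaryOp_blockOp_iff.1 hU
  obtain ⟨⟨u₀₀, -, -, u₁₁⟩, v₀₀, -, -, v₁₁⟩ := isUnitaryOp_blockOp_iff.1 hU
  simp only [hA, hD, ContinuousLinearMap.adjoint_comp, ContinuousLinearMap.adjoint_adjoint,
    ContinuousLinearMap.comp_apply, neg_apply, map_neg, neg_neg, add_neg_eq_zero]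
    at u₀₀ u₀₁ u₁₀ u₁₁ v₀₀ v₁₁ t₀₀
  -- The off-diagonal entries of `U* U = 1` say that `X` and `X*` intertwine the two Gram operators;
  -- this turns the diagonal entries into one-sided inverse relations.
  have g₁₀ : (.id ℂ H₀ + X ∘L X†) ∘L (U₁₀† ∘L U₁₀) = .id ℂ H₀ := by
    ext v
    simp only [add_apply, ContinuousLinearMap.comp_apply, ContinuousLinearMap.id_apply]
    rw [← u₁₀, add_comm, u₀₀]
  have g₀₁ : (.id ℂ H₁ + X† ∘L X) ∘L (U₀₁† ∘L U₀₁) = .id ℂ H₁ := by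
    ext v
    simp only [add_apply, ContinuousLinearMap.comp_apply, ContinuousLinearMap.id_apply]
    rw [u₀₁, u₁₁]
  have i₁₀ : U₁₀.IsInvertible := by
    -- The lower right entry of `U U* = 1` reads `U₁₀ (1 + X X*) U₁₀* = 1`, which suggests the
    -- inverse.
    refine .of_inverse (g := (.id ℂ H₀ + X ∘L X†) ∘L U₁₀†) ?_ ?_
    · ext v
      simp only [add_apply, ContinuousLinearMap.comp_apply, ContinuousLinearMap.id_apply, map_add]
      rw [v₁₁]
    · rw [ContinuousLinearMap.comp_assoc, g₁₀]
  have i₀₁ : U₀₁.IsInvertible := by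
    refine .of_inverse (g := (.id ℂ H₁ + X† ∘L X) ∘L U₀₁†) ?_ ?_
    · ext v
      simp only [add_apply, ContinuousLinearMap.comp_apply, ContinuousLinearMap.id_apply, map_add]
      rw [add_comm, v₀₀]
    · rw [ContinuousLinearMap.comp_assoc, g₀₁]
  refine ⟨⟨i₀₁, i₁₀, ?_, ?_, ?_, ?_, ?_⟩, hA, hD⟩
  · ext w
    simp only [ContinuousLinearMap.comp_apply, t₁₀, i₁₀.self_apply_inverse]
  · ext w
    simp only [ContinuousLinearMap.comp_apply, ← e₁₀,
      (isInvertible_adjoint i₀₁).inverse_apply_self]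
  · refine inverse_eq_of_adjoint_eq_self ?_ (adjoint_adjoint_comp_self _) g₁₀
    simpa using adjoint_id_add_adjoint_comp_self (X†)
  · exact inverse_eq_of_adjoint_eq_self (adjoint_id_add_adjoint_comp_self X)
      (adjoint_adjoint_comp_self _) g₀₁
  -- As `U₁₀` is onto, it suffices to test on vectors `U₁₀ v`, where the claim is the upper left
  -- entry of the intertwining relation.
  · rw [mem_ker_sigmaOp]
    intro w
    obtain ⟨v, rfl⟩ := i₁₀.surjective w
    have := t₀₀ v
    simp only [sub_apply, ContinuousLinearMap.comp_apply, map_sub, i₁₀.inverse_apply_self,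
      ← t₁₀] at this ⊢
    rw [this]
    abel

theorem isUnitaryOp_of_intertwiningConditions {U₀₁ : H₁ →L[ℂ] K₀} {U₁₀ : H₀ →L[ℂ] K₁}
    (h : IntertwiningConditions T₀ T₁ X S₀ S₁ Y U₀₁ U₁₀) :
    IsUnitaryOp (blockOp (U₀₁ ∘L X†) U₀₁ U₁₀ (-(U₁₀ ∘L X))) ∧
      blockOp (U₀₁ ∘L X†) U₀₁ U₁₀ (-(U₁₀ ∘L X)) ∘L upperOp T₀ T₁ X =
        upperOp S₀ S₁ Y ∘L blockOp (U₀₁ ∘L X†) U₀₁ U₁₀ (-(U₁₀ ∘L X)) := by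
  obtain ⟨i₀₁, i₁₀, s₁₀, s₀₁, g₁₀, g₀₁, hY⟩ := h
  -- No positivity argument is needed: the Gram condition equates `inverse` with an invertible
  -- operator, which rules out its default value for a non-invertible argument.
  have j₁₀ : (ContinuousLinearMap.id ℂ H₀ + X ∘L X†).IsInvertible :=
    .of_isInvertible_inverse (g₁₀ ▸ (isInvertible_adjoint i₁₀).comp i₁₀)
  have j₀₁ : (ContinuousLinearMap.id ℂ H₁ + X† ∘L X).IsInvertible :=
    .of_isInvertible_inverse (g₀₁ ▸ (isInvertible_adjoint i₀₁).comp i₀₁)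
  have a₁₀ (v) : (U₁₀†) (U₁₀ v) + X ((X†) ((U₁₀†) (U₁₀ v))) = v := by
    simpa [g₁₀] using j₁₀.self_apply_inverse v
  have b₁₀ (v) : (U₁₀†) (U₁₀ v) + (U₁₀†) (U₁₀ (X ((X†) v))) = v := by
    simpa [g₁₀] using j₁₀.inverse_apply_self v
  have a₀₁ (v) : (U₀₁†) (U₀₁ v) + (X†) (X ((U₀₁†) (U₀₁ v))) = v := by
    simpa [g₀₁] using j₀₁.self_apply_inverse v
  have b₀₁ (v) : (U₀₁†) (U₀₁ v) + (U₀₁†) (U₀₁ ((X†) (X v))) = v := by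
    simpa [g₀₁] using j₀₁.inverse_apply_self v
  -- `X (1 + X* X)⁻¹ = (1 + X X*)⁻¹ X`
  have c (v) : X ((U₀₁†) (U₀₁ v)) = (U₁₀†) (U₁₀ (X v)) := by
    conv_rhs => rw [← a₀₁ v]
    simp only [map_add]
    rw [b₁₀]
  have c' (v) : (X†) ((U₁₀†) (U₁₀ v)) = (U₀₁†) (U₀₁ ((X†) v)) := by
    conv_rhs => rw [← a₁₀ v]
    simp only [map_add]
    rw [b₀₁]
  have t₁₀ (v) : S₁ (U₁₀ v) = U₁₀ (T₀ v) := by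
    simp [← s₁₀, i₁₀.inverse_apply_self]
  have t₀₁ (w) : (U₀₁†) (S₀ w) = T₁ ((U₀₁†) w) := by
    simp [← s₀₁, (isInvertible_adjoint i₀₁).self_apply_inverse]
  have tY (v) : S₀ (Y (U₁₀ v)) - S₀ (U₀₁ ((X†) v)) =
      Y (U₁₀ (T₀ v)) - U₀₁ ((X†) (T₀ v)) := by
    simpa [i₁₀.inverse_apply_self, t₁₀] using mem_ker_sigmaOp.1 hY (U₁₀ v)
  have d₀₁ (w) : U₀₁ ((U₀₁†) w) + U₀₁ ((X†) (X ((U₀₁†) w))) = w := by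
    obtain ⟨v, rfl⟩ := i₀₁.surjective w
    rw [← map_add, a₀₁]
  have d₁₀ (w) : U₁₀ ((U₁₀†) w) + U₁₀ (X ((X†) ((U₁₀†) w))) = w := by
    obtain ⟨v, rfl⟩ := i₁₀.surjective w
    rw [← map_add, a₁₀]
  -- `S₀ U₀₁ (1 + X* X) = U₀₁ (1 + X* X) T₁`
  have tX (v) : S₀ (U₀₁ v) + S₀ (U₀₁ ((X†) (X v))) = U₀₁ (T₁ v) + U₀₁ ((X†) (X (T₁ v))) := by
    obtain ⟨w, rfl⟩ := (isInvertible_adjoint i₀₁).surjective v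
    rw [← map_add, d₀₁, ← t₀₁, d₀₁]
  constructor
  · rw [isUnitaryOp_blockOp_iff]
    simp only [map_neg, ContinuousLinearMap.adjoint_comp, ContinuousLinearMap.adjoint_adjoint,
      ContinuousLinearMap.comp_apply, neg_apply, neg_neg]
    refine ⟨⟨?_, ?_, ?_, ?_⟩, ?_, ?_, ?_, ?_⟩ <;> intro v
    · rw [← c', add_comm, a₁₀]
    · rw [c, add_neg_cancel]
    · rw [c', add_neg_cancel]
    · rw [← c, a₀₁]
    · rw [add_comm, d₀₁]
    · rw [add_neg_cancel]
    · rw [add_neg_cancel]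
    · rw [d₁₀]
  · rw [blockOp_comp_upperOp_eq_iff]
    simp only [ContinuousLinearMap.comp_apply, neg_apply, map_neg, t₁₀]
    refine ⟨?_, ?_, ?_, ?_⟩ <;> intro v
    · rw [← sub_eq_zero, ← sub_eq_zero.2 (tY v)]
      abel
    -- The upper right entry is minus the relation `tX` at `v` minus the relation `tY` at `X v`; the
    -- terms `S₀ U₀₁ X* X v` cancel.
    · have h : -(S₀ (U₀₁ v) + S₀ (U₀₁ ((X†) (X v))) -
          (U₀₁ (T₁ v) + U₀₁ ((X†) (X (T₁ v))))) -
          (S₀ (Y (U₁₀ (X v))) - S₀ (U₀₁ ((X†) (X v))) -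
          (Y (U₁₀ (T₀ (X v))) - U₀₁ ((X†) (T₀ (X v))))) = 0 := by
        rw [sub_eq_zero.2 (tX v), sub_eq_zero.2 (tY (X v)), neg_zero, sub_zero]
      rw [← sub_eq_zero, ← h]
      abel
    · trivial
    · abel

end Intertwining

theorem lemma2p5 {H₀ H₁ K₀ K₁ : Type*}
    [NormedAddCommGroup H₀] [InnerProductSpace ℂ H₀] [CompleteSpace H₀]
    [NormedAddCommGroup H₁] [InnerProductSpace ℂ H₁] [CompleteSpace H₁]
    [NormedAddCommGroup K₀] [InnerProductSpace ℂ K₀] [CompleteSpace K₀]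
    [NormedAddCommGroup K₁] [InnerProductSpace ℂ K₁] [CompleteSpace K₁]
    (T₀ : H₀ →L[ℂ] H₀) (T₁ : H₁ →L[ℂ] H₁) (X : H₁ →L[ℂ] H₀)
    (S₀ : K₀ →L[ℂ] K₀) (S₁ : K₁ →L[ℂ] K₁) (Y : K₁ →L[ℂ] K₀)
    (h₀ : LinearMap.ker (sigmaOp T₀ S₀) = ⊥)
    (h₁ : LinearMap.ker (sigmaOp S₁ T₁) = ⊥) :
    -- a unitary intertwiner exists iff there are entries satisfying the three conditions
    ((∃ U : HilbertSum H₀ H₁ →L[ℂ] HilbertSum K₀ K₁,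
        IsUnitaryOp U ∧ U ∘L upperOp T₀ T₁ X = upperOp S₀ S₁ Y ∘L U) ↔
      ∃ (U₀₁ : H₁ →L[ℂ] K₀) (U₁₀ : H₀ →L[ℂ] K₁),
        IntertwiningConditions T₀ T₁ X S₀ S₁ Y U₀₁ U₁₀) ∧
    -- every unitary intertwiner has the stated form, with its own entries satisfying the
    -- conditions, and conversely
    (∀ (U₀₀ : H₀ →L[ℂ] K₀) (U₀₁ : H₁ →L[ℂ] K₀) (U₁₀ : H₀ →L[ℂ] K₁) (U₁₁ : H₁ →L[ℂ] K₁),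
      (IsUnitaryOp (blockOp U₀₀ U₀₁ U₁₀ U₁₁) ∧
        blockOp U₀₀ U₀₁ U₁₀ U₁₁ ∘L upperOp T₀ T₁ X =
          upperOp S₀ S₁ Y ∘L blockOp U₀₀ U₀₁ U₁₀ U₁₁) ↔
      (IntertwiningConditions T₀ T₁ X S₀ S₁ Y U₀₁ U₁₀ ∧
        U₀₀ = U₀₁ ∘L X† ∧ U₁₁ = -(U₁₀ ∘L X))) := by
  have key (U₀₀ : H₀ →L[ℂ] K₀) (U₀₁ : H₁ →L[ℂ] K₀) (U₁₀ : H₀ →L[ℂ] K₁) (U₁₁ : H₁ →L[ℂ] K₁) :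
      (IsUnitaryOp (blockOp U₀₀ U₀₁ U₁₀ U₁₁) ∧
        blockOp U₀₀ U₀₁ U₁₀ U₁₁ ∘L upperOp T₀ T₁ X =
          upperOp S₀ S₁ Y ∘L blockOp U₀₀ U₀₁ U₁₀ U₁₁) ↔
      (IntertwiningConditions T₀ T₁ X S₀ S₁ Y U₀₁ U₁₀ ∧
        U₀₀ = U₀₁ ∘L X† ∧ U₁₁ = -(U₁₀ ∘L X)) := by
    refine ⟨fun h => intertwiningConditions_of_isUnitaryOp h₀ h₁ h.1 h.2, ?_⟩
    rintro ⟨h, rfl, rfl⟩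
    exact isUnitaryOp_of_intertwiningConditions h
  refine ⟨⟨?_, ?_⟩, key⟩
  · rintro ⟨U, hU⟩
    obtain ⟨U₀₀, U₀₁, U₁₀, U₁₁, rfl⟩ := exists_eq_blockOp U
    exact ⟨U₀₁, U₁₀, ((key _ _ _ _).1 hU).1⟩
  · rintro ⟨U₀₁, U₁₀, h⟩
    exact ⟨_, (key _ _ _ _).2 ⟨h, rfl, rfl⟩⟩
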